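/- **Theorem.** Let $\mathcal{A}$ be a finite set of affine hyperplanes in $\mathbb{C}^{l}$ and let $Y\subset\mathbb{C}^{l}$ be a complex line through the origin. Write $M(\mathcal{A})=\mathbb{C}^{l}\setminus\bigcup_{H\in\mathcal{A}}H$. Let $L(\mathcal{A})$ be the set of all nonempty intersections of subfamilies of $\mathcal{A}$ (the empty intersection being $\mathbb{C}^{l}$), and let $L_{2}(\mathcal{A})\subset L(\mathcal{A})$ be the subset of its elements of codimension $2$. Let $\mathcal{A}_{Y}=\{H\in\mathcal{A}\mid H \text{ is parallel to } Y\}$, where $H$ is parallel to $Y$ if $Y$ is contained in the direction of $H$. Let $p_{Y}\colon\mathbb{C}^{l}\to\mathbb{C}^{l}/Y$ be the quotient map, and let $p\mathcal{A}_{Y}=\{p_{Y}(H)\mid H\in\mathcal{A}_{Y}\}$, which is an affine arrangement in $\mathbb{C}^{l}/Y$ with complement $M(p\mathcal{A}_{Y})$. Then $p_{Y}$ restricts to a surjection $\pi_{Y}\colon M(\mathcal{A})\to M(p\mathcal{A}_{Y})$, and the following are equivalent. 1. The map $\pi_{Y}\colon M(\mathcal{A})\to M(p\mathcal{A}_{Y})$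 is a (locally trivial) fiber bundle. 2. Each fiber of $\pi_{Y}$ is $\mathbb{C}$ with $|\mathcal{A}\setminus\mathcal{A}_{Y}|$ points removed. This condition is equivalent to the others in each of its two readings: - (a) for every $b\in M(p\mathcal{A}_{Y})$, the fiber $\pi_{Y}^{-1}(b)$ is the complex affine line $p_{Y}^{-1}(b)$ with exactly $|\mathcal{A}\setminus\mathcal{A}_{Y}|$ points removed; - (b) for every $b\in M(p\mathcal{A}_{Y})$, the fiber $\pi_{Y}^{-1}(b)$ is homeomorphic to $\mathbb{C}\setminus S$ for some set $S\subset\mathbb{C}$ with exactly $|\mathcal{A}\setminus\mathcal{A}_{Y}|$ elements. 3. The line $Y$ is good, i.e. $X+Y\in L(\mathcal{A})$ for all $X\in L_{2}(\mathcal{A})$. -/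

import Mathlib

open scoped Pointwise

/-- `X` is an affine hyperplane of `V`: a nonempty affine subspace of codimension one. -/
def IsAffineHyperplane {V : Type*} [AddCommGroup V] [Module ℂ V]
    (H : AffineSubspace ℂ V) : Prop :=
  (H : Set V).Nonempty ∧ Module.finrank ℂ (V ⧸ H.direction) = 1

/-- The image of an affine hyperplane parallel to `Y` is an affine hyperplane of `V ⧸ Y`. -/
theorem IsAffineHyperplane.map_mkQ {V : Type*} [AddCommGroup V] [Module ℂ V]
    {H : AffineSubspace ℂ V} (hH : IsAffineHyperplane H) {Y : Submodule ℂ V}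
    (hY : Y ≤ H.direction) : IsAffineHyperplane (H.map Y.mkQ.toAffineMap) := by
  obtain ⟨⟨x, hx⟩, hd⟩ := hH
  refine ⟨⟨Y.mkQ x, ⟨x, hx, rfl⟩⟩, ?_⟩
  rw [AffineSubspace.map_direction, LinearMap.toAffineMap_linear,
    (Submodule.quotientQuotientEquivQuotient Y H.direction hY).finrank_eq, hd]

/-- A finite arrangement of affine hyperplanes in the complex vector space `V`. -/
structure AffineArrangement (V : Type*) [AddCommGroup V] [Module ℂ V] where
  /-- the hyperplanes of the arrangement -/
  hyperplanes : Set (AffineSubspace ℂ V)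
  finite : hyperplanes.Finite
  isAffineHyperplane : ∀ H ∈ hyperplanes, IsAffineHyperplane H

namespace AffineArrangement

variable {V : Type*} [AddCommGroup V] [Module ℂ V]

/-- The complement `M(A)` of the union of the hyperplanes. -/
def complement (A : AffineArrangement V) : Set V :=
  (⋃ H ∈ A.hyperplanes, (H : Set V))ᶜ

/-- The intersection poset `L(A)`: all nonempty intersections of hyperplanes of `A`,
the whole space being the empty intersection. -/
def intersectionPoset (A : AffineArrangement V) : Set (AffineSubspace ℂ V) :=
  {X | (X : Set V).Nonempty ∧ ∃ S ⊆ A.hyperplanes, X = sInf S}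

/-- `L_k(A)`: the elements of `L(A)` of rank (that is, codimension) `k`. -/
def rankPart (A : AffineArrangement V) (k : ℕ) : Set (AffineSubspace ℂ V) :=
  {X | X ∈ A.intersectionPoset ∧ Module.finrank ℂ (V ⧸ X.direction) = k}

/-- `A_Y`: the hyperplanes of `A` that are parallel to the linear subspace `Y`. -/
def parallelTo (A : AffineArrangement V) (Y : Submodule ℂ V) : Set (AffineSubspace ℂ V) :=
  {H | H ∈ A.hyperplanes ∧ Y ≤ H.direction}

/-- `pA_Y`: the arrangement in `V ⧸ Y` of the images of the hyperplanes parallel to `Y`. -/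
def projected (A : AffineArrangement V) (Y : Submodule ℂ V) : AffineArrangement (V ⧸ Y) where
  hyperplanes := (fun H => H.map Y.mkQ.toAffineMap) '' A.parallelTo Y
  finite := (A.finite.subset fun _ h => h.1).image _
  isAffineHyperplane := by
    rintro _ ⟨H, hH, rfl⟩
    exact (A.isAffineHyperplane H hH.1).map_mkQ hH.2

theorem mapsTo_mkQ (A : AffineArrangement V) (Y : Submodule ℂ V) :
    Set.MapsTo Y.mkQ A.complement (A.projected Y).complement := by
  intro x hx hx'
  simp only [Set.mem_iUnion] at hx'
  obtain ⟨_, ⟨H, hH, rfl⟩, h, hh, hhx⟩ := hx'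
  refine hx (Set.mem_biUnion hH.1 ?_)
  have hsub : x - h ∈ Y := (Submodule.Quotient.eq Y).1 hhx.symm
  simpa using AffineSubspace.vadd_mem_of_mem_direction (hH.2 hsub) hh

/-- `π_Y : M(A) → M(pA_Y)`: the restriction of the quotient map `V → V ⧸ Y`. -/
def proj (A : AffineArrangement V) (Y : Submodule ℂ V) :
    A.complement → (A.projected Y).complement :=
  (A.mapsTo_mkQ Y).restrict

/-- `Y` is good: `X + Y ∈ L(A)` for all `X ∈ L_2(A)`. -/
def IsGood (A : AffineArrangement V) (Y : Submodule ℂ V) : Prop :=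
  ∀ X ∈ A.rankPart 2, ∃ Z ∈ A.intersectionPoset, (Z : Set V) = (X : Set V) + (Y : Set V)

end AffineArrangement

/-- `π : E → B` is a fiber bundle: there is a space `F` such that every point of `B` has an open
neighbourhood `U` with `π⁻¹(U) ≃ₜ U × F` over `U`. -/
def IsFiberBundleMap {E B : Type} [TopologicalSpace E] [TopologicalSpace B] (π : E → B) : Prop :=
  ∃ (F : Type) (_ : TopologicalSpace F), ∀ b : B, ∃ e : Bundle.Trivialization F π, b ∈ e.baseSet

/-!
Choose a splitting `V ≅ (V ⧸ Y) × ℂ` (`LineSplitting`). A hyperplane of `A` parallel to `Y` is the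
preimage of its image in `V ⧸ Y`, and a hyperplane transversal to `Y` is the graph of an affine
function `V ⧸ Y → ℂ` (`AffineArrangement.Transversal.graph`). So the complement of `A` is, over the
complement `B` of `A.projected Y`, the trivial plane bundle minus the graphs of these functions, and
the fiber over `b` is a plane minus the finite set of their values at `b`. All four conditions are
equivalent to `AffineArrangement.Separated`: at every point of `B` the affine functions take
pairwise distinct values.

* Counting points of a fiber as a subset of the line is immediate. Up to homeomorphism, the number of
  missing points is recovered from the ends: a plane minus `n` points has exactly `n + 1` ends
  (`PuncturedPlane.card_eq_of_homeomorph`).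
* In a fiber bundle all fibers are homeomorphic, and over a generic point of `B` the values are
  distinct (`AffineArrangement.exists_mem_complement_injective_graph`), so they are distinct
  everywhere.
* Conversely, if the values are distinct everywhere, the fibers are identified locally by pushing the
  missing points along small displacements, multiplied by tent functions; this perturbs the identity
  by a contraction, hence is a homeomorphism
  (`GraphComplement.exists_trivialization`). As `B` is connected, one model fiber suffices.
* A coincidence of two values over `b` means that `b` is in the image of the codimension-two
  intersection `X` of two transversal hyperplanes. If `Y` is good, then `X + Y` lies in a hyperplane
  of `A` parallel to `Y`, so `b` is not in `B`. If no hyperplane parallel to `Y` contains `X`, a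
  generic point of `X` maps into `B`, and a coincidence does occur
  (`AffineArrangement.IsGood.separated`, `AffineArrangement.Separated.isGood`).
-/

/-! ### Ends of a plane with finitely many points removed -/

/-- The complement of some compact subset of `X` is the disjoint union, indexed by `ι`, of open sets
none of which is relatively compact. For finite `ι` this says that `X` has at least as many ends as
`ι` has elements. -/
def HasEndsSplitting (X ι : Type*) [TopologicalSpace X] : Prop :=
  ∃ (K : Set X) (U : ι → Set X), IsCompact K ∧ (∀ i, IsOpen (U i)) ∧
    Pairwise (fun i j => Disjoint (U i) (U j)) ∧ (⋃ i, U i) = Kᶜ ∧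
    ∀ i, ∀ C : Set X, IsCompact C → ¬ U i ⊆ C

theorem HasEndsSplitting.of_homeomorph {X X' ι : Type*} [TopologicalSpace X] [TopologicalSpace X']
    (e : X ≃ₜ X') (h : HasEndsSplitting X ι) : HasEndsSplitting X' ι := by
  obtain ⟨K, U, hK, hU, hd, hc, hn⟩ := h
  refine ⟨e.symm ⁻¹' K, fun i => e.symm ⁻¹' (U i), ?_, fun i => (hU i).preimage e.symm.continuous,
    fun i j hij => (hd hij).preimage _, ?_, fun i C hC hUC => hn i (e ⁻¹' C) ?_ ?_⟩
  · exact e.symm.isCompact_preimage.2 hK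
  · rw [← Set.preimage_iUnion, hc, Set.preimage_compl]
  · exact e.isCompact_preimage.2 hC
  · intro x hx
    exact hUC (by simpa using hx)

namespace PuncturedPlane

/-- The standard neighbourhoods of the ends of `ℂ` minus `S`: the punctured disc of radius `r` around
each point of `S`, and the complement of the closed disc of radius `R`. -/
def endNhd (S : Finset ℂ) (r R : ℝ) : Option S → Set {z : ℂ // z ∉ S}
  | none => {z | R < ‖(z : ℂ)‖}
  | some s => {z | ‖(z : ℂ) - s‖ < r}

theorem isOpen_endNhd (S : Finset ℂ) (r R : ℝ) (o : Option S) : IsOpen (endNhd S r R o) := by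
  cases o with
  | none => exact isOpen_lt continuous_const (by fun_prop)
  | some s => exact isOpen_lt (by fun_prop) continuous_const

theorem isCompact_compl_iUnion_endNhd (S : Finset ℂ) {r : ℝ} (hr : 0 < r) (R : ℝ) :
    IsCompact (⋃ o, endNhd S r R o)ᶜ := by
  rw [Subtype.isCompact_iff]
  have key : ((↑) '' (⋃ o, endNhd S r R o)ᶜ : Set ℂ) =
      {z | ‖z‖ ≤ R} ∩ ⋂ s ∈ S, {z | r ≤ ‖z - s‖} := by
    ext z
    simp only [Set.mem_image, Set.mem_compl_iff, Set.mem_iUnion, not_exists, Option.forall,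
      Set.mem_inter_iff, Set.mem_iInter, Set.mem_ofPred_eq, endNhd, not_lt, Subtype.forall]
    constructor
    · rintro ⟨z, ⟨h1, h2⟩, rfl⟩
      exact ⟨h1, h2⟩
    · rintro ⟨h1, h2⟩
      refine ⟨⟨z, fun hz => ?_⟩, ⟨h1, h2⟩, rfl⟩
      have := h2 z hz
      simp at this
      linarith
  rw [key]
  refine Metric.isCompact_of_isClosed_isBounded (IsClosed.inter ?_ ?_) ?_
  · exact isClosed_le (by fun_prop) continuous_const
  · exact isClosed_biInter fun s _ => isClosed_le continuous_const (by fun_prop)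
  · refine (Metric.isBounded_closedBall (x := (0 : ℂ)) (r := R)).subset fun z hz => ?_
    simpa using hz.1

theorem not_endNhd_subset_of_isCompact (S : Finset ℂ) {r : ℝ} (hr : 0 < r) (R : ℝ) (o : Option S)
    (C : Set {z : ℂ // z ∉ S}) (hC : IsCompact C) : ¬ endNhd S r R o ⊆ C := by
  intro h
  have hC' : IsCompact ((↑) '' C : Set ℂ) := hC.image continuous_subtype_val
  cases o with
  | none =>
    obtain ⟨M, hM⟩ := (hC'.isBounded.union S.finite_toSet.isBounded).subset_closedBall 0
    obtain ⟨x, hx1, hx2⟩ : ∃ x : ℝ, R < ‖(x : ℂ)‖ ∧ M < ‖(x : ℂ)‖ := by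
      refine ⟨|R| + |M| + 1, ?_, ?_⟩ <;>
      · rw [Complex.norm_real, Real.norm_eq_abs]
        refine lt_of_lt_of_le ?_ (le_abs_self _)
        linarith [le_abs_self R, le_abs_self M, abs_nonneg R, abs_nonneg M]
    have hxS : (x : ℂ) ∉ S := fun hS => by
      have := hM (Or.inr hS)
      rw [mem_closedBall_zero_iff] at this
      linarith
    have := hM (Or.inl ⟨_, h (a := ⟨x, hxS⟩) hx1, rfl⟩)
    rw [mem_closedBall_zero_iff] at this
    linarith
  | some s =>
    -- The missing point `s` would be a limit of the compact set.
    have hs : (s : ℂ) ∈ closure ((↑) '' C : Set ℂ) := by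
      have h1 : ∀ᶠ z in nhdsWithin (s : ℂ) {(s : ℂ)}ᶜ, z ∈ ((↑) '' C : Set ℂ) := by
        have h2 : ∀ᶠ z in nhds (s : ℂ), z ∉ ((S.erase s : Finset ℂ) : Set ℂ) :=
          (S.erase s).finite_toSet.isClosed.isOpen_compl.mem_nhds (by simp)
        filter_upwards [self_mem_nhdsWithin, nhdsWithin_le_nhds h2,
          nhdsWithin_le_nhds (Metric.ball_mem_nhds (s : ℂ) hr)] with z hz1 hz2 hz3
        refine ⟨⟨z, fun hz => hz2 ?_⟩, h ?_, rfl⟩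
        · exact Finset.mem_coe.2 (Finset.mem_erase.2 ⟨hz1, hz⟩)
        · simpa [endNhd, dist_eq_norm] using hz3
      exact mem_closure_of_frequently_of_tendsto h1.frequently
        (Filter.tendsto_id.mono_left nhdsWithin_le_nhds)
    rw [hC'.isClosed.closure_eq] at hs
    obtain ⟨z, -, hz⟩ := hs
    exact z.2 (hz ▸ s.2)

theorem isPreconnected_setOf_norm_lt_norm {R : ℝ} (hR : 0 < R) :
    IsPreconnected {z : ℂ | R < ‖z‖} := by
  have h : {z : ℂ | R < ‖z‖} = Complex.exp '' {w | Real.log R < w.re} := by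
    ext z
    constructor
    · intro hz
      have hz0 : z ≠ 0 := by
        rintro rfl
        simp at hz
        linarith
      refine ⟨Complex.log z, ?_, Complex.exp_log hz0⟩
      simpa [Complex.log_re] using Real.log_lt_log hR hz
    · rintro ⟨w, hw, rfl⟩
      rw [Set.mem_ofPred_eq, Complex.norm_exp]
      exact (Real.log_lt_iff_lt_exp hR).1 hw
  rw [h]
  exact (convex_halfSpace_re_gt _).isPreconnected.image _ Complex.continuous_exp.continuousOn

theorem isPreconnected_puncturedBall (s : ℂ) {r : ℝ} (hr : 0 < r) :
    IsPreconnected {z : ℂ | z ≠ s ∧ ‖z - s‖ < r} := by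
  have h : {z : ℂ | z ≠ s ∧ ‖z - s‖ < r} =
      (fun w => s + Complex.exp w) '' {w | w.re < Real.log r} := by
    ext z
    constructor
    · rintro ⟨hz, hzr⟩
      have hz0 : z - s ≠ 0 := sub_ne_zero.2 hz
      refine ⟨Complex.log (z - s), ?_, by simp [Complex.exp_log hz0]⟩
      simpa [Complex.log_re] using Real.log_lt_log (norm_pos_iff.2 hz0) hzr
    · rintro ⟨w, hw, rfl⟩
      refine ⟨by simp [Complex.exp_ne_zero], ?_⟩
      simpa [Complex.norm_exp] using (Real.lt_log_iff_exp_lt hr).1 hw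
  rw [h]
  exact (convex_halfSpace_re_lt _).isPreconnected.image _ (by fun_prop)

/-- Radii for which the standard neighbourhoods of the ends are pairwise disjoint and connected. -/
structure IsAdmissible (S : Finset ℂ) (r R : ℝ) : Prop where
  radius_pos : 0 < r
  outer_pos : 0 < R
  separated : ∀ s ∈ S, ∀ t ∈ S, s ≠ t → 2 * r ≤ ‖s - t‖
  norm_add_radius_le : ∀ s ∈ S, ‖s‖ + r ≤ R

/-- The standard neighbourhoods of the ends can be chosen disjoint from a given compact set. -/
theorem exists_isAdmissible_disjoint (S : Finset ℂ) {K : Set {z : ℂ // z ∉ S}} (hK : IsCompact K) :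
    ∃ r R, IsAdmissible S r R ∧ ∀ o, Disjoint (endNhd S r R o) K := by
  have hK' : IsCompact ((↑) '' K : Set ℂ) := hK.image continuous_subtype_val
  have hr : ∀ᶠ r : ℝ in nhdsWithin 0 (Set.Ioi 0), 0 < r ∧
      (∀ s ∈ S, ∀ t ∈ S, s ≠ t → 2 * r ≤ ‖s - t‖) ∧
      ∀ s ∈ S, Disjoint (Metric.ball s r) ((↑) '' K : Set ℂ) := by
    refine (eventually_mem_nhdsWithin).and (Filter.Eventually.and ?_ ?_)
    · refine nhdsWithin_le_nhds ?_
      refine (Filter.eventually_all_finset S).2 fun s _ =>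
        (Filter.eventually_all_finset S).2 fun t _ => Filter.eventually_imp_distrib_left.2 fun hst => ?_
      have h0 : Filter.Tendsto (fun r : ℝ => 2 * r) (nhds 0) (nhds (2 * 0)) :=
        Filter.Tendsto.const_mul _ Filter.tendsto_id
      rw [mul_zero] at h0
      exact h0.eventually_le_const (norm_pos_iff.2 (sub_ne_zero.2 hst))
    · refine (Filter.eventually_all_finset S).2 fun s hs => ?_
      have hsK : s ∈ ((↑) '' K : Set ℂ)ᶜ := by
        rintro ⟨z, -, rfl⟩
        exact z.2 hs
      obtain ⟨ε, hε, hball⟩ := Metric.isOpen_iff.1 hK'.isClosed.isOpen_compl s hsK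
      filter_upwards [nhdsWithin_le_nhds (Iio_mem_nhds hε)] with r hr
      exact Set.disjoint_left.2 fun z hz => hball (Metric.ball_subset_ball (le_of_lt hr) hz)
  obtain ⟨r, hr0, hsep, hdisj⟩ := hr.exists
  obtain ⟨M, hM⟩ := (hK'.isBounded.union S.finite_toSet.isBounded).subset_closedBall 0
  refine ⟨r, |M| + r, ⟨hr0, by positivity, hsep, fun s hs => ?_⟩, fun o => ?_⟩
  · have := hM (Or.inr hs)
    rw [mem_closedBall_zero_iff] at this
    linarith [le_abs_self M]
  · refine Set.disjoint_left.2 fun z hz hzK => ?_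
    cases o with
    | none =>
      have := hM (Or.inl ⟨z, hzK, rfl⟩)
      rw [mem_closedBall_zero_iff] at this
      have hz' : |M| + r < ‖(z : ℂ)‖ := hz
      linarith [le_abs_self M]
    | some s =>
      have hz' : ‖(z : ℂ) - s‖ < r := hz
      exact Set.disjoint_left.1 (hdisj s s.2) (mem_ball_iff_norm.2 hz') ⟨z, hzK, rfl⟩

theorem IsAdmissible.pairwise_disjoint {S : Finset ℂ} {r R : ℝ} (h : IsAdmissible S r R) :
    Pairwise fun o o' => Disjoint (endNhd S r R o) (endNhd S r R o') := by
  have main : ∀ s ∈ S, ∀ z : ℂ, ‖z - s‖ < r → ¬ R < ‖z‖ := by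
    intro s hs z hz hR
    have h1 := h.norm_add_radius_le s hs
    have h2 := norm_add_le (z - s) s
    rw [sub_add_cancel] at h2
    linarith
  rintro (_ | s) (_ | t) hst <;> refine Set.disjoint_left.2 fun z hz hz' => ?_
  · exact hst rfl
  · exact main t t.2 z hz' hz
  · exact main s s.2 z hz hz'
  · have hne : (s : ℂ) ≠ t := fun h' => hst (congrArg some (Subtype.ext h'))
    have h1 := h.separated s s.2 t t.2 hne
    have h2 := norm_sub_le ((z : ℂ) - (t : ℂ)) ((z : ℂ) - (s : ℂ))
    rw [sub_sub_sub_cancel_left] at h2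
    have h3 : ‖(z : ℂ) - (s : ℂ)‖ < r := hz
    have h4 : ‖(z : ℂ) - (t : ℂ)‖ < r := hz'
    linarith

theorem IsAdmissible.isPreconnected_endNhd {S : Finset ℂ} {r R : ℝ} (h : IsAdmissible S r R)
    (o : Option S) : IsPreconnected (endNhd S r R o) := by
  refine Topology.IsInducing.subtypeVal.isPreconnected_image.1 ?_
  have hr := h.radius_pos
  cases o with
  | none =>
    convert isPreconnected_setOf_norm_lt_norm h.outer_pos using 1
    ext z
    refine ⟨fun ⟨w, hw, hwz⟩ => hwz ▸ hw, fun hz => ⟨⟨z, fun hzS => ?_⟩, hz, rfl⟩⟩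
    have h1 := h.norm_add_radius_le z hzS
    have h2 : R < ‖z‖ := hz
    linarith
  | some s =>
    convert isPreconnected_puncturedBall s hr using 1
    ext z
    constructor
    · rintro ⟨w, hw, rfl⟩
      exact ⟨fun hws => w.2 (hws ▸ s.2), hw⟩
    · rintro ⟨hz, hzr⟩
      refine ⟨⟨z, fun hzS => ?_⟩, hzr, rfl⟩
      linarith [h.separated z hzS s s.2 hz]

theorem hasEndsSplitting (S : Finset ℂ) : HasEndsSplitting {z : ℂ // z ∉ S} (Option S) := by
  obtain ⟨r, R, h, -⟩ := exists_isAdmissible_disjoint S isCompact_empty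
  exact ⟨_, endNhd S r R, isCompact_compl_iUnion_endNhd S h.radius_pos R, isOpen_endNhd S r R,
    h.pairwise_disjoint, (compl_compl _).symm,
    fun o C hC => not_endNhd_subset_of_isCompact S h.radius_pos R o C hC⟩

/-- Each standard neighbourhood of an end is connected, so it lies in a single piece of the
splitting; a piece containing none of them would be relatively compact. -/
theorem card_le_of_hasEndsSplitting (S : Finset ℂ) {ι : Type*} [Fintype ι]
    (h : HasEndsSplitting {z : ℂ // z ∉ S} ι) : Fintype.card ι ≤ S.card + 1 := by
  obtain ⟨K, U, hK, hU, hd, hc, hn⟩ := h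
  obtain ⟨r, R, hrR, hdisj⟩ := exists_isAdmissible_disjoint S hK
  have hf : ∀ o, ∃ i, endNhd S r R o ⊆ U i := by
    intro o
    have hsub : endNhd S r R o ⊆ ⋃ i, U i := by
      rw [hc]
      exact Set.subset_compl_iff_disjoint_right.2 (hdisj o)
    obtain ⟨x, hx⟩ : (endNhd S r R o).Nonempty := by
      by_contra hempty
      rw [Set.not_nonempty_iff_eq_empty] at hempty
      exact not_endNhd_subset_of_isCompact S hrR.radius_pos R o ∅ isCompact_empty hempty.le
    obtain ⟨i, hi⟩ := Set.mem_iUnion.1 (hsub hx)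
    refine ⟨i, (hrR.isPreconnected_endNhd o).subset_left_of_subset_union (hU i)
      (isOpen_biUnion (s := {j | j ≠ i}) fun j _ => hU j) ?_ ?_ ⟨x, hx, hi⟩⟩
    · exact Set.disjoint_iUnion₂_right.2 fun j hj => hd (Ne.symm hj)
    · intro y hy
      obtain ⟨j, hj⟩ := Set.mem_iUnion.1 (hsub hy)
      by_cases hji : j = i
      · exact Or.inl (hji ▸ hj)
      · exact Or.inr (Set.mem_biUnion (show j ∈ {j | j ≠ i} from hji) hj)
  choose f hf using hf
  have hsurj : Function.Surjective f := by
    intro i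
    by_contra hi
    push Not at hi
    refine hn i _ (isCompact_compl_iUnion_endNhd S hrR.radius_pos R) fun x hx hx' => ?_
    obtain ⟨o, ho⟩ := Set.mem_iUnion.1 hx'
    exact Set.disjoint_left.1 (hd (hi o)) (hf o ho) hx
  simpa using Fintype.card_le_of_surjective f hsurj

/-- A plane minus `n` points has exactly `n + 1` ends. -/
theorem card_eq_of_homeomorph {S T : Finset ℂ} (e : {z : ℂ // z ∉ S} ≃ₜ {z : ℂ // z ∉ T}) :
    S.card = T.card := by
  have h1 := card_le_of_hasEndsSplitting T ((hasEndsSplitting S).of_homeomorph e)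
  have h2 := card_le_of_hasEndsSplitting S ((hasEndsSplitting T).of_homeomorph e.symm)
  simp at h1 h2
  omega

end PuncturedPlane

/-! ### Fiber bundles of punctured planes -/

/-- A homeomorphism `π⁻¹(U) ≃ₜ U × F` over an open set `U` is a local trivialization. -/
theorem exists_trivialization_of_homeomorph {E B F : Type*} [TopologicalSpace E]
    [TopologicalSpace B] [TopologicalSpace F] [Nonempty F] {π : E → B} (hπ : Continuous π)
    {U : Set B} (hU : IsOpen U) {x : B} (hx : x ∈ U) (H : π ⁻¹' U ≃ₜ U × F)
    (hH : ∀ e, ((H e).1 : B) = π e) : ∃ e : Bundle.Trivialization F π, x ∈ e.baseSet := by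
  classical
  refine ⟨{
    toFun e := if he : π e ∈ U then ⟨(H ⟨e, he⟩).1, (H ⟨e, he⟩).2⟩ else ⟨x, Classical.arbitrary F⟩
    invFun xi := H.symm (if h : xi.1 ∈ U then ⟨xi.1, h⟩ else ⟨x, hx⟩, xi.2)
    source := π ⁻¹' U
    target := U ×ˢ Set.univ
    map_source' e (he : π e ∈ U) := by simp [he]
    map_target' _ _ := Subtype.coe_prop _
    left_inv' e (he : π e ∈ U) := by simp [he]
    right_inv' xi := by rintro ⟨hx, -⟩; simpa [hx] using fun h ↦ (h (H.symm _).2).elim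
    open_source := hU.preimage hπ
    open_target := hU.prod isOpen_univ
    continuousOn_toFun := continuousOn_iff_continuous_domRestrict.mpr <|
      ((continuous_subtype_val.prodMap continuous_id).comp H.continuous).congr
      fun ⟨e, (he : π e ∈ U)⟩ ↦ by simp [Prod.map, he]
    continuousOn_invFun := continuousOn_iff_continuous_domRestrict.mpr <|
      ((continuous_subtype_val.comp H.symm.continuous).comp (by fun_prop :
        Continuous fun ui ↦ ⟨⟨_, ui.2.1⟩, ui.1.2⟩)).congr fun ⟨⟨x, i⟩, ⟨hx, _⟩⟩ ↦ by simp [hx]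
    baseSet := U
    open_baseSet := hU
    source_eq := rfl
    target_eq := rfl
    proj_toFun e (he : π e ∈ U) := by simp [he, hH] }, hx⟩

theorem bijective_add_of_contracting {E : Type*} [NormedAddCommGroup E] [CompleteSpace E]
    {h : E → E} (hh : LipschitzWith (1 / 2) h) : Function.Bijective fun z => z + h z := by
  constructor
  · intro z z' hzz'
    have h1 := hh.dist_le_mul z z'
    have h2 : z - z' = h z' - h z := by
      have : z + h z = z' + h z' := hzz'
      rw [sub_eq_sub_iff_add_eq_add, this, add_comm]
    have h3 : dist z z' = dist (h z) (h z') := by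
      rw [dist_eq_norm, h2, dist_comm, dist_eq_norm]
    rw [← h3] at h1
    push_cast at h1
    exact dist_le_zero.1 (by linarith)
  · intro w
    have hc : ContractingWith (1 / 2) fun z => w - h z := by
      refine ⟨NNReal.half_lt_self one_ne_zero, LipschitzWith.of_dist_le_mul fun x y => ?_⟩
      rw [dist_sub_left]
      exact hh.dist_le_mul x y
    refine ⟨ContractingWith.fixedPoint _ hc, ?_⟩
    have : w - h (ContractingWith.fixedPoint _ hc) = _ := hc.fixedPoint_isFixedPt
    exact (sub_eq_iff_eq_add.1 this).symm

/-- A continuous family of maps `z ↦ z + h b z`, each a contractive perturbation of the identity,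
is a homeomorphism of `B × E` over `B`. -/
theorem exists_homeomorph_add_of_contracting {B E : Type*} [TopologicalSpace B]
    [NormedAddCommGroup E] [CompleteSpace E] {h : B → E → E} (hc : ∀ z, Continuous fun b => h b z)
    (hh : ∀ b, LipschitzWith (1 / 2) (h b)) :
    ∃ Φ : B × E ≃ₜ B × E, ∀ p, Φ p = (p.1, p.2 + h p.1 p.2) := by
  let e : ∀ b, E ≃ E := fun b => Equiv.ofBijective _ (bijective_add_of_contracting (hh b))
  have he : ∀ b z, e b z = z + h b z := fun b z => rfl
  have hes : ∀ b w, (e b).symm w + h b ((e b).symm w) = w := fun b w => (e b).apply_symm_apply w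
  have hjoint : Continuous fun p : B × E => h p.1 p.2 :=
    continuous_prod_of_continuous_lipschitzWith' _ (1 / 2) hh hc
  have hinv : Continuous fun p : B × E => (e p.1).symm p.2 := by
    rw [continuous_iff_continuousAt]
    rintro ⟨b', w'⟩
    set z' := (e b').symm w' with hz'
    rw [ContinuousAt, tendsto_iff_dist_tendsto_zero]
    have hbound : ∀ p : B × E, dist ((e p.1).symm p.2) z' ≤
        2 * (dist p.2 w' + dist (h p.1 z') (h b' z')) := by
      rintro ⟨b, w⟩
      set z := (e b).symm w with hz
      have h1 : z + h b z = w := hes b w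
      have h2 : z' + h b' z' = w' := hes b' w'
      have h3 := (hh b).dist_le_mul z z'
      push_cast at h3
      have h4 : z - z' = (w - w') - (h b z - h b z') - (h b z' - h b' z') := by
        rw [← h1, ← h2]
        abel
      have h5 : dist z z' ≤ dist w w' + dist (h b z) (h b z') + dist (h b z') (h b' z') := by
        simp only [dist_eq_norm]
        rw [h4]
        exact (norm_sub_le _ _).trans (add_le_add_left (norm_sub_le _ _) _)
      simp only
      linarith
    refine squeeze_zero (fun _ => dist_nonneg) hbound ?_
    have hcont : Continuous fun p : B × E => 2 * (dist p.2 w' + dist (h p.1 z') (h b' z')) := by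
      have := (hc z').comp (continuous_fst (X := B) (Y := E))
      simp only [Function.comp_def] at this
      fun_prop
    simpa using hcont.tendsto (b', w')
  exact ⟨{
    toFun := fun p => (p.1, p.2 + h p.1 p.2)
    invFun := fun p => (p.1, (e p.1).symm p.2)
    left_inv := fun p => Prod.ext rfl ((e p.1).symm_apply_apply p.2)
    right_inv := fun p => Prod.ext rfl ((e p.1).apply_symm_apply p.2)
    continuous_toFun := by fun_prop
    continuous_invFun := by fun_prop }, fun _ => rfl⟩

/-- The trivial plane bundle over `B` with the graphs of the functions `g i` removed. -/
def GraphComplement {B ι : Type*} (g : ι → B → ℂ) : Type _ :=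
  {p : B × ℂ // ∀ i, p.2 ≠ g i p.1}

instance {B ι : Type*} [TopologicalSpace B] (g : ι → B → ℂ) :
    TopologicalSpace (GraphComplement g) :=
  inferInstanceAs (TopologicalSpace {p : B × ℂ // ∀ i, p.2 ≠ g i p.1})

/-- The projection of the complement of the graphs to the base. -/
def GraphComplement.proj {B ι : Type*} (g : ι → B → ℂ) (p : GraphComplement g) : B := p.1.1

theorem GraphComplement.continuous_proj {B ι : Type*} [TopologicalSpace B] (g : ι → B → ℂ) :
    Continuous (GraphComplement.proj g) :=
  continuous_fst.comp continuous_subtype_val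

/-- The tent function of radius `r` around `a`. -/
noncomputable def tent (r : ℝ) (a z : ℂ) : ℝ := max 0 (1 - ‖z - a‖ / r)

theorem tent_self (r : ℝ) (a : ℂ) : tent r a a = 1 := by simp [tent]

theorem tent_eq_zero {r : ℝ} (hr : 0 < r) {a z : ℂ} (h : r ≤ ‖z - a‖) : tent r a z = 0 := by
  rw [tent, max_eq_left]
  linarith [(one_le_div hr).2 h]

theorem abs_tent_sub_tent_le {r : ℝ} (hr : 0 < r) (a z z' : ℂ) :
    |tent r a z - tent r a z'| ≤ ‖z - z'‖ / r := by
  have h1 := abs_max_sub_max_le_abs (1 - ‖z - a‖ / r) (1 - ‖z' - a‖ / r) 0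
  rw [max_comm _ (0 : ℝ), max_comm _ (0 : ℝ)] at h1
  refine h1.trans ?_
  have h2 : 1 - ‖z - a‖ / r - (1 - ‖z' - a‖ / r) = (‖z' - a‖ - ‖z - a‖) / r := by ring
  rw [h2, abs_div, abs_of_pos hr]
  gcongr
  have h3 := abs_norm_sub_norm_le (z' - a) (z - a)
  rwa [sub_sub_sub_cancel_right, norm_sub_rev z' z] at h3

/-- Near `b₀`, pushing each `g i b₀` to `g i b` by a tent function gives a homeomorphism of the
plane, close to the identity and depending continuously on `b`, which carries the fiber over `b₀`
to the fiber over `b`. -/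
theorem GraphComplement.exists_trivialization {B ι : Type*} [TopologicalSpace B] [Fintype ι]
    (g : ι → B → ℂ) (hg : ∀ i, Continuous (g i)) (b₀ : B)
    (hinj : Function.Injective fun i => g i b₀) :
    ∃ e : Bundle.Trivialization {z : ℂ // ∀ i, z ≠ g i b₀} (GraphComplement.proj g),
      b₀ ∈ e.baseSet := by
  obtain ⟨r, hr, hsep⟩ : ∃ r : ℝ, 0 < r ∧ ∀ i j, i ≠ j → r ≤ ‖g i b₀ - g j b₀‖ := by
    have : ∀ᶠ r : ℝ in nhdsWithin 0 (Set.Ioi 0), 0 < r ∧ ∀ i j, i ≠ j → r ≤ ‖g i b₀ - g j b₀‖ := by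
      refine eventually_mem_nhdsWithin.and (nhdsWithin_le_nhds ?_)
      refine Filter.eventually_all.2 fun i => Filter.eventually_all.2 fun j =>
        Filter.eventually_imp_distrib_left.2 fun hij => ?_
      exact Filter.tendsto_id.eventually_le_const (norm_pos_iff.2 (sub_ne_zero.2 (hinj.ne hij)))
    exact this.exists
  -- The total displacement is kept below `r / 2`, to make the perturbation `1 / 2`-Lipschitz.
  let U : Set B := {b | ∑ i, ‖g i b - g i b₀‖ < r / 2}
  have hU : IsOpen U := isOpen_lt (by fun_prop) continuous_const
  have hb₀ : b₀ ∈ U := by simp [U, hr]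
  let h : U → ℂ → ℂ := fun b z => ∑ i, (tent r (g i b₀) z : ℂ) * (g i b - g i b₀)
  have hh : ∀ b, LipschitzWith (1 / 2) (h b) := by
    intro b
    refine LipschitzWith.of_dist_le_mul fun z z' => ?_
    rw [dist_eq_norm, dist_eq_norm]
    have hbU : ∑ i, ‖g i b - g i b₀‖ < r / 2 := b.2
    calc ‖h b z - h b z'‖
        = ‖∑ i, ((tent r (g i b₀) z - tent r (g i b₀) z' : ℝ) : ℂ) * (g i b - g i b₀)‖ := by
          simp only [h, ← Finset.sum_sub_distrib]
          congr 1
          refine Finset.sum_congr rfl fun i _ => ?_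
          push_cast
          ring
      _ ≤ ∑ i, ‖z - z'‖ / r * ‖g i b - g i b₀‖ := by
          refine norm_sum_le_of_le _ fun i _ => ?_
          rw [norm_mul, Complex.norm_real, Real.norm_eq_abs]
          gcongr
          exact abs_tent_sub_tent_le hr _ _ _
      _ = ‖z - z'‖ / r * ∑ i, ‖g i b - g i b₀‖ := by rw [Finset.mul_sum]
      _ ≤ ‖z - z'‖ / r * (r / 2) := by gcongr
      _ = _ := by
          push_cast
          field_simp
  have hval : ∀ (b : U) i, g i b₀ + h b (g i b₀) = g i b := by
    intro b i
    have : h b (g i b₀) = g i b - g i b₀ := by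
      simp only [h]
      rw [Finset.sum_eq_single i]
      · simp [tent_self]
      · intro j _ hj
        simp [tent_eq_zero hr (hsep i j hj.symm)]
      · simp
    rw [this]
    ring
  obtain ⟨Φ, hΦ⟩ := exists_homeomorph_add_of_contracting (h := h)
    (fun z => by simp only [h]; fun_prop) hh
  have hΦ1 : ∀ p, (Φ.symm p).1 = p.1 := fun p => by
    have := congrArg Prod.fst (hΦ (Φ.symm p))
    simpa using this.symm
  have hΦg : ∀ (b : U) i, Φ (b, g i b₀) = (b, g i b) := fun b i => by rw [hΦ, hval]
  have hΦne : ∀ (p : U × ℂ), (∀ i, p.2 ≠ g i b₀) ↔ ∀ i, (Φ p).2 ≠ g i p.1 := by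
    intro p
    refine forall_congr' fun i => not_congr ⟨fun hp => ?_, fun hp => ?_⟩
    · have : p = (p.1, g i b₀) := Prod.ext rfl hp
      rw [this, hΦg]
    · have : Φ p = Φ (p.1, g i b₀) := by
        rw [hΦg]
        exact Prod.ext (by rw [hΦ]) hp
      exact congrArg Prod.snd (Φ.injective this)
  have : Nonempty {z : ℂ // ∀ i, z ≠ g i b₀} := by
    obtain ⟨z, hz⟩ := (Set.finite_range fun i => g i b₀).infinite_compl.nonempty
    exact ⟨z, fun i hi => hz ⟨i, hi.symm⟩⟩
  let H : GraphComplement.proj g ⁻¹' U ≃ₜ U × {z : ℂ // ∀ i, z ≠ g i b₀} := {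
    toFun := fun p => (⟨p.1.1.1, p.2⟩, ⟨(Φ.symm (⟨p.1.1.1, p.2⟩, p.1.1.2)).2, by
      rw [hΦne, Φ.apply_symm_apply, hΦ1]
      exact p.1.2⟩)
    invFun := fun q => ⟨⟨(q.1, (Φ (q.1, q.2.1)).2), (hΦne (q.1, q.2.1)).1 q.2.2⟩, q.1.2⟩
    left_inv := by
      rintro ⟨⟨⟨b, z⟩, hz⟩, hb⟩
      refine Subtype.ext (Subtype.ext (Prod.ext rfl ?_))
      have h1 : ((⟨b, hb⟩ : U), (Φ.symm (⟨b, hb⟩, z)).2) = Φ.symm (⟨b, hb⟩, z) :=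
        Prod.ext (hΦ1 (⟨b, hb⟩, z)).symm rfl
      change (Φ (⟨b, hb⟩, (Φ.symm (⟨b, hb⟩, z)).2)).2 = z
      rw [h1, Φ.apply_symm_apply]
    right_inv := by
      rintro ⟨b, z, hz⟩
      refine Prod.ext rfl (Subtype.ext ?_)
      have h1 : (b, (Φ (b, z)).2) = Φ (b, z) := Prod.ext (by rw [hΦ]) rfl
      change (Φ.symm (b, (Φ (b, z)).2)).2 = z
      rw [h1, Φ.symm_apply_apply]
    continuous_toFun := by
      have c1 : Continuous fun p : GraphComplement.proj g ⁻¹' U => p.1.1 :=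
        continuous_subtype_val.comp continuous_subtype_val
      have c2 : Continuous fun p : GraphComplement.proj g ⁻¹' U => (⟨p.1.1.1, p.2⟩ : U) :=
        (continuous_fst.comp c1).subtype_mk _
      exact c2.prodMk ((continuous_snd.comp (Φ.symm.continuous.comp
        (c2.prodMk (continuous_snd.comp c1)))).subtype_mk _)
    continuous_invFun := by
      have c1 : Continuous fun q : U × {z : ℂ // ∀ i, z ≠ g i b₀} => (q.1, q.2.1) := by fun_prop
      exact (((continuous_subtype_val.comp continuous_fst).prodMk
        (continuous_snd.comp (Φ.continuous.comp c1))).subtype_mk _).subtype_mk _ }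
  exact exists_trivialization_of_homeomorph (GraphComplement.continuous_proj g) hU hb₀ H
    fun _ => rfl

/-- Over a connected base, locally trivial near each point with any fibers means locally trivial
with one common fiber. -/
theorem IsFiberBundleMap.of_forall_exists_trivialization {E B : Type} [TopologicalSpace E]
    [TopologicalSpace B] [Nonempty B] [PreconnectedSpace B] {π : E → B} {F : B → Type}
    [∀ b, TopologicalSpace (F b)]
    (h : ∀ b, ∃ e : Bundle.Trivialization (F b) π, b ∈ e.baseSet) : IsFiberBundleMap π := by
  let P : B → B → Prop := fun b b' => Nonempty (F b ≃ₜ F b')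
  have : Std.Symm P := ⟨fun _ _ ⟨e⟩ => ⟨e.symm⟩⟩
  have hP : ∀ b b', P b b' := by
    refine PreconnectedSpace.induction₂ P (fun b => ?_) ⟨fun _ _ _ ⟨e⟩ ⟨e'⟩ => ⟨e.trans e'⟩⟩
    obtain ⟨e, he⟩ := h b
    filter_upwards [e.open_baseSet.mem_nhds he] with b' hb'
    obtain ⟨e', he'⟩ := h b'
    exact ⟨(e.preimageSingletonHomeomorph hb').symm.trans (e'.preimageSingletonHomeomorph he')⟩
  obtain ⟨b₀⟩ := ‹Nonempty B›
  refine ⟨F b₀, inferInstance, fun b => ?_⟩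
  obtain ⟨e, he⟩ := h b
  obtain ⟨f⟩ := hP b b₀
  exact ⟨e.transFiberHomeomorph f, he⟩

theorem IsFiberBundleMap.comp_homeomorph {E E' B : Type} [TopologicalSpace E]
    [TopologicalSpace E'] [TopologicalSpace B] {π : E → B} (hπ : IsFiberBundleMap π) (f : E' ≃ₜ E) :
    IsFiberBundleMap (π ∘ f) := by
  obtain ⟨F, hF, h⟩ := hπ
  refine ⟨F, hF, fun b => ?_⟩
  obtain ⟨e, he⟩ := h b
  exact ⟨e.compHomeomorph f, he⟩

theorem IsFiberBundleMap.nonempty_homeomorph_fibers {E B : Type} [TopologicalSpace E]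
    [TopologicalSpace B] {π : E → B} (hπ : IsFiberBundleMap π) (b b' : B) :
    Nonempty (π ⁻¹' {b} ≃ₜ π ⁻¹' {b'}) := by
  obtain ⟨F, hF, h⟩ := hπ
  obtain ⟨e, he⟩ := h b
  obtain ⟨e', he'⟩ := h b'
  exact ⟨(e.preimageSingletonHomeomorph he).trans (e'.preimageSingletonHomeomorph he').symm⟩

/-! ### Affine functions and hyperplanes -/

namespace AffineMap

variable {V : Type*} [AddCommGroup V] [Module ℂ V]

theorem finite_setOf_lineMap_eq_zero {f : V →ᵃ[ℂ] ℂ} {x y : V} (h : f x ≠ 0 ∨ f y ≠ 0) :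
    {t : ℂ | f (lineMap x y t) = 0}.Finite := by
  refine Set.Subsingleton.finite fun t ht t' ht' => ?_
  simp only [Set.mem_ofPred_eq, apply_lineMap, lineMap_apply_ring'] at ht ht'
  by_contra hne
  have h1 : (t - t') * (f y - f x) = 0 := by linear_combination ht - ht'
  have h2 : f y - f x = 0 := (mul_eq_zero.1 h1).resolve_left (sub_ne_zero.2 hne)
  rw [h2] at ht
  have h3 : f x = 0 := by simpa using ht
  exact h.elim (fun h => h h3) fun h => h (by rw [← h3]; exact sub_eq_zero.1 h2)

/-- Finitely many affine functions, none vanishing identically on `X`, have a common non-zero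
on `X`. -/
theorem exists_mem_forall_ne_zero {X : AffineSubspace ℂ V} (hX : (X : Set V).Nonempty)
    {s : Set (V →ᵃ[ℂ] ℂ)} (hs : s.Finite) (h : ∀ f ∈ s, ∃ x ∈ X, f x ≠ 0) :
    ∃ x ∈ X, ∀ f ∈ s, f x ≠ 0 := by
  induction s, hs using Set.Finite.induction_on with
  | empty => exact ⟨hX.some, hX.some_mem, by simp⟩
  | @insert f s _ hs ih =>
    obtain ⟨x, hxX, hx⟩ := ih fun g hg => h g (Set.mem_insert_of_mem _ hg)
    obtain ⟨y, hyX, hy⟩ := h f (Set.mem_insert _ _)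
    have hfin : ({t : ℂ | f (lineMap x y t) = 0} ∪
        ⋃ g ∈ s, {t : ℂ | g (lineMap x y t) = 0}).Finite :=
      (finite_setOf_lineMap_eq_zero (Or.inr hy)).union
        (hs.biUnion fun g hg => finite_setOf_lineMap_eq_zero (Or.inl (hx g hg)))
    obtain ⟨t, ht⟩ := hfin.infinite_compl.nonempty
    simp only [Set.mem_compl_iff, Set.mem_union, Set.mem_iUnion, Set.mem_ofPred_eq, not_or,
      not_exists] at ht
    refine ⟨lineMap x y t, lineMap_mem t hxX hyX, fun g hg => ?_⟩
    obtain rfl | hg := hg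
    · exact ht.1
    · exact ht.2 g hg

end AffineMap

namespace IsAffineHyperplane

variable {V : Type*} [AddCommGroup V] [Module ℂ V] {H : AffineSubspace ℂ V}

theorem exists_equation (hH : IsAffineHyperplane H) :
    ∃ f : V →ᵃ[ℂ] ℂ, (∀ v, v ∈ H ↔ f v = 0) ∧ (∀ v, v ∈ H.direction ↔ f.linear v = 0) ∧
      ∃ v, f v ≠ 0 := by
  obtain ⟨⟨x, hx⟩, hd⟩ := hH
  have : FiniteDimensional ℂ (V ⧸ H.direction) := Module.finite_of_finrank_eq_succ hd
  let e : (V ⧸ H.direction) ≃ₗ[ℂ] ℂ := LinearEquiv.ofFinrankEq _ _ (by rw [hd, Module.finrank_self])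
  let α : V →ₗ[ℂ] ℂ := e.toLinearMap ∘ₗ H.direction.mkQ
  have hα : ∀ v, v ∈ H.direction ↔ α v = 0 := fun v => by simp [α]
  refine ⟨α.toAffineMap - AffineMap.const ℂ V (α x), fun v => ?_, fun v => ?_, ?_⟩
  · rw [← AffineSubspace.vsub_right_mem_direction_iff_mem hx, hα]
    simp
  · rw [hα]
    simp
  · obtain ⟨v, hv⟩ := (e.surjective.comp H.direction.mkQ_surjective) (α x + 1)
    refine ⟨v, ?_⟩
    have : α v = α x + 1 := hv
    simp [this]

theorem finrank_direction [FiniteDimensional ℂ V] (hH : IsAffineHyperplane H) :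
    Module.finrank ℂ H.direction + 1 = Module.finrank ℂ V := by
  rw [← Submodule.finrank_quotient_add_finrank H.direction, hH.2, add_comm]

end IsAffineHyperplane

namespace AffineArrangement

variable {V : Type*} [AddCommGroup V] [Module ℂ V]

theorem exists_equations (A : AffineArrangement V) :
    ∃ s : Set (V →ᵃ[ℂ] ℂ), s.Finite ∧ (∀ f ∈ s, ∃ v, f v ≠ 0) ∧
      A.complement = {v | ∀ f ∈ s, f v ≠ 0} := by
  choose f hf using fun H : A.hyperplanes => (A.isAffineHyperplane H H.2).exists_equation
  have := A.finite.to_subtype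
  refine ⟨Set.range f, Set.finite_range f, ?_, ?_⟩
  · rintro _ ⟨H, rfl⟩
    exact (hf H).2.2
  · ext v
    simp only [complement, Set.mem_compl_iff, Set.mem_iUnion, not_exists, Set.mem_ofPred_eq,
      Set.forall_mem_range, ne_eq, ← (hf _).1, Subtype.forall, SetLike.mem_coe]

theorem isPreconnected_complement [TopologicalSpace V] [IsTopologicalAddGroup V]
    [ContinuousSMul ℂ V] (A : AffineArrangement V) : IsPreconnected A.complement := by
  obtain ⟨s, hs, -, h⟩ := A.exists_equations
  rw [h]
  refine isPreconnected_of_forall_pair fun x hx y hy => ?_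
  -- The complex line through `x` and `y` meets the complement in the line minus a finite set.
  have hfin : (⋃ f ∈ s, {t : ℂ | f (AffineMap.lineMap x y t) = 0}).Finite :=
    hs.biUnion fun f hf => AffineMap.finite_setOf_lineMap_eq_zero (Or.inl (hx f hf))
  have hconn := hfin.countable.isConnected_compl_of_one_lt_rank
    (by rw [Complex.rank_real_complex]; norm_num)
  refine ⟨AffineMap.lineMap x y '' _, ?_, ⟨0, ?_, AffineMap.lineMap_apply_zero x y⟩, ⟨1, ?_, AffineMap.lineMap_apply_one x y⟩,
    hconn.isPreconnected.image _ AffineMap.lineMap_continuous.continuousOn⟩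
  · rintro _ ⟨t, ht, rfl⟩ f hf hft
    exact ht (Set.mem_biUnion hf hft)
  · simpa using hx
  · simpa using hy

theorem mkQ_mem_map_iff {Y : Submodule ℂ V} {H : AffineSubspace ℂ V} (hY : Y ≤ H.direction) (v : V) :
    Y.mkQ v ∈ H.map Y.mkQ.toAffineMap ↔ v ∈ H := by
  refine ⟨?_, fun hv => ⟨v, hv, rfl⟩⟩
  rintro ⟨h, hh, hv⟩
  have hsub : v - h ∈ Y := (Submodule.Quotient.eq Y).1 hv.symm
  simpa using AffineSubspace.vadd_mem_of_mem_direction (hY hsub) hh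

theorem mkQ_mem_complement_projected_iff (A : AffineArrangement V) (Y : Submodule ℂ V) (v : V) :
    Y.mkQ v ∈ (A.projected Y).complement ↔ ∀ H ∈ A.parallelTo Y, v ∉ H := by
  simp only [complement, projected, Set.mem_compl_iff, Set.mem_iUnion, not_exists,
    Set.forall_mem_image]
  exact forall₂_congr fun H hH => not_congr (mkQ_mem_map_iff hH.2 v)

end AffineArrangement

/-! ### Coordinates adapted to a line -/

/-- A splitting `V ≅ (V ⧸ Y) × ℂ` for a line `Y`, consisting of a basis vector of `Y`, a linear
form taking the value `1` on it, and the section of `V → V ⧸ Y` with image the kernel of the form. -/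
structure LineSplitting {V : Type*} [AddCommGroup V] [Module ℂ V] (Y : Submodule ℂ V) where
  /-- the basis vector of the line -/
  vec : V
  /-- the coordinate along the line -/
  coord : V →ₗ[ℂ] ℂ
  /-- the section of the quotient map -/
  sec : V ⧸ Y →ₗ[ℂ] V
  vec_mem : vec ∈ Y
  coord_vec : coord vec = 1
  sec_mkQ : ∀ v, sec (Y.mkQ v) = v - coord v • vec

namespace LineSplitting

variable {V : Type*} [AddCommGroup V] [Module ℂ V] {Y : Submodule ℂ V}

theorem nonempty_of_finrank_eq_one (hY : Module.finrank ℂ Y = 1) : Nonempty (LineSplitting Y) := by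
  have : FiniteDimensional ℂ Y := Module.finite_of_finrank_eq_succ hY
  let e : Y ≃ₗ[ℂ] ℂ := LinearEquiv.ofFinrankEq _ _ (by rw [hY, Module.finrank_self])
  obtain ⟨c, hc⟩ := LinearMap.exists_extend e.toLinearMap
  have hc' : ∀ y : Y, c y = e y := fun y => LinearMap.congr_fun hc y
  have hker : Y ≤ (LinearMap.id - c.smulRight ((e.symm 1 : Y) : V)).ker := by
    intro y hy
    have h : (⟨y, hy⟩ : Y) = e ⟨y, hy⟩ • e.symm 1 := by
      rw [← map_smul, smul_eq_mul, mul_one, e.symm_apply_apply]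
    have h' := congrArg Subtype.val h
    rw [← hc'] at h'
    simpa [sub_eq_zero] using h'
  exact ⟨⟨e.symm 1, c, Y.liftQ _ hker, (e.symm 1).2, by simp [hc'], fun v => by simp⟩⟩

theorem mkQ_vec (s : LineSplitting Y) : Y.mkQ s.vec = 0 := by simpa using s.vec_mem

theorem mkQ_sec (s : LineSplitting Y) (q : V ⧸ Y) : Y.mkQ (s.sec q) = q := by
  obtain ⟨v, rfl⟩ := Y.mkQ_surjective q
  rw [s.sec_mkQ, map_sub, map_smul, s.mkQ_vec, smul_zero, sub_zero]

theorem coord_sec (s : LineSplitting Y) (q : V ⧸ Y) : s.coord (s.sec q) = 0 := by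
  obtain ⟨v, rfl⟩ := Y.mkQ_surjective q
  simp [-Submodule.mkQ_apply, s.sec_mkQ, s.coord_vec]

theorem sec_add_coord (s : LineSplitting Y) (v : V) :
    s.sec (Y.mkQ v) + s.coord v • s.vec = v := by
  rw [s.sec_mkQ, sub_add_cancel]

/-- The point of `V` with given coordinates. -/
def point (s : LineSplitting Y) (q : V ⧸ Y) (z : ℂ) : V := s.sec q + z • s.vec

theorem mkQ_point (s : LineSplitting Y) (q : V ⧸ Y) (z : ℂ) : Y.mkQ (s.point q z) = q := by
  rw [point, map_add, map_smul, s.mkQ_vec, smul_zero, add_zero, s.mkQ_sec]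

theorem coord_point (s : LineSplitting Y) (q : V ⧸ Y) (z : ℂ) : s.coord (s.point q z) = z := by
  simp [point, s.coord_sec, s.coord_vec]

theorem point_mkQ_coord (s : LineSplitting Y) (v : V) : s.point (Y.mkQ v) (s.coord v) = v :=
  s.sec_add_coord v

theorem le_of_vec_mem (s : LineSplitting Y) {D : Submodule ℂ V} (h : s.vec ∈ D) : Y ≤ D := by
  intro y hy
  have h0 : Y.mkQ y = 0 := by simpa using hy
  rw [← s.sec_add_coord y, h0, map_zero, zero_add]
  exact D.smul_mem _ h

/-- A hyperplane not parallel to `Y` is the graph of an affine function on `V ⧸ Y`. -/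
theorem exists_graph (s : LineSplitting Y) {H : AffineSubspace ℂ V} (hH : IsAffineHyperplane H)
    (hHY : ¬ Y ≤ H.direction) :
    ∃ g : V ⧸ Y →ᵃ[ℂ] ℂ, ∀ v, v ∈ H ↔ s.coord v = g (Y.mkQ v) := by
  obtain ⟨f, hf, hfd, -⟩ := hH.exists_equation
  have ha : f.linear s.vec ≠ 0 := fun h => hHY (s.le_of_vec_mem ((hfd _).2 h))
  refine ⟨(-(f.linear s.vec)⁻¹) • f.comp s.sec.toAffineMap, fun v => ?_⟩
  have h1 : f v = f (s.sec (Y.mkQ v)) + s.coord v * f.linear s.vec := by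
    conv_lhs => rw [← s.sec_add_coord v, add_comm, ← vadd_eq_add, f.map_vadd]
    rw [map_smul, smul_eq_mul, vadd_eq_add, add_comm]
  rw [hf, h1]
  simp only [AffineMap.coe_smul, Pi.smul_apply, AffineMap.comp_apply, LinearMap.coe_toAffineMap,
    smul_eq_mul]
  constructor
  · intro h
    field_simp
    linear_combination h
  · intro h
    rw [h]
    field_simp
    ring

variable [TopologicalSpace V]

theorem continuous_sec [IsTopologicalAddGroup V] [ContinuousSMul ℂ V] [T2Space V]
    [FiniteDimensional ℂ V] (s : LineSplitting Y) : Continuous s.sec := by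
  rw [(Submodule.isQuotientMap_mkQ Y).continuous_iff]
  exact (s.sec ∘ₗ Y.mkQ).continuous_of_finiteDimensional

/-- The coordinates of a point, as a homeomorphism. -/
def homeomorph [IsTopologicalAddGroup V] [ContinuousSMul ℂ V] [T2Space V]
    [FiniteDimensional ℂ V] (s : LineSplitting Y) : V ≃ₜ (V ⧸ Y) × ℂ where
  toFun v := (Y.mkQ v, s.coord v)
  invFun p := s.point p.1 p.2
  left_inv v := s.point_mkQ_coord v
  right_inv p := Prod.ext (s.mkQ_point _ _) (s.coord_point _ _)
  continuous_toFun := (Submodule.isQuotientMap_mkQ Y).continuous.prodMk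
    s.coord.continuous_of_finiteDimensional
  continuous_invFun := by
    have := s.continuous_sec
    unfold point
    fun_prop

end LineSplitting

/-! ### The fibers of the projection -/

namespace AffineArrangement

variable {V : Type*} [AddCommGroup V] [Module ℂ V] {A : AffineArrangement V} {Y : Submodule ℂ V}

/-- The hyperplanes of `A` that are not parallel to `Y`. -/
abbrev Transversal (A : AffineArrangement V) (Y : Submodule ℂ V) : Type _ :=
  ↥(A.hyperplanes \ A.parallelTo Y)

theorem finite_transversal (A : AffineArrangement V) (Y : Submodule ℂ V) :
    (A.hyperplanes \ A.parallelTo Y).Finite :=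
  A.finite.subset Set.sdiff_subset

noncomputable instance : Fintype (A.Transversal Y) := (A.finite_transversal Y).fintype

theorem Transversal.not_le (H : A.Transversal Y) : ¬ Y ≤ H.1.direction :=
  fun h => H.2.2 ⟨H.2.1, h⟩

theorem Transversal.exists_graph (s : LineSplitting Y) (H : A.Transversal Y) :
    ∃ g : V ⧸ Y →ᵃ[ℂ] ℂ, ∀ v, v ∈ H.1 ↔ s.coord v = g (Y.mkQ v) :=
  s.exists_graph (A.isAffineHyperplane _ H.2.1) H.not_le

/-- The affine function on `V ⧸ Y` whose graph is the given hyperplane. -/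
noncomputable def Transversal.graph (s : LineSplitting Y) (H : A.Transversal Y) : V ⧸ Y →ᵃ[ℂ] ℂ :=
  (H.exists_graph s).choose

theorem Transversal.mem_iff (s : LineSplitting Y) (H : A.Transversal Y) (v : V) :
    v ∈ H.1 ↔ s.coord v = H.graph s (Y.mkQ v) :=
  (H.exists_graph s).choose_spec v

theorem Transversal.point_mem_iff (s : LineSplitting Y) (H : A.Transversal Y) (q : V ⧸ Y) (z : ℂ) :
    s.point q z ∈ H.1 ↔ z = H.graph s q := by
  rw [H.mem_iff s, s.mkQ_point, s.coord_point]

theorem Transversal.graph_injective (s : LineSplitting Y) :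
    Function.Injective (Transversal.graph (A := A) s) := by
  intro H H' h
  refine Subtype.ext (SetLike.ext fun v => ?_)
  rw [H.mem_iff s, H'.mem_iff s, h]

theorem mem_complement_iff (s : LineSplitting Y) (v : V) :
    v ∈ A.complement ↔ Y.mkQ v ∈ (A.projected Y).complement ∧
      ∀ H : A.Transversal Y, s.coord v ≠ H.graph s (Y.mkQ v) := by
  rw [mkQ_mem_complement_projected_iff]
  simp only [complement, Set.mem_compl_iff, Set.mem_iUnion, not_exists, SetLike.mem_coe]
  constructor
  · exact fun h => ⟨fun H hH => h H hH.1, fun H hH => h H H.2.1 ((H.mem_iff s v).2 hH)⟩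
  · intro h H hH hv
    by_cases hHY : H ∈ A.parallelTo Y
    · exact h.1 H hHY hv
    · exact h.2 ⟨H, hH, hHY⟩ ((Transversal.mem_iff s ⟨H, hH, hHY⟩ v).1 hv)

theorem point_mem_complement_iff (s : LineSplitting Y) (b : (A.projected Y).complement) (z : ℂ) :
    s.point b z ∈ A.complement ↔ ∀ H : A.Transversal Y, z ≠ H.graph s b := by
  rw [mem_complement_iff s, s.mkQ_point, s.coord_point]
  exact and_iff_right b.2

open Classical in
/-- The points to be removed from the line over `q`, in terms of their coordinate along `Y`. -/
noncomputable def removedPoints (A : AffineArrangement V) (s : LineSplitting Y) (q : V ⧸ Y) :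
    Finset ℂ :=
  Finset.univ.image fun H : A.Transversal Y => H.graph s q

theorem notMem_removedPoints_iff (s : LineSplitting Y) (q : V ⧸ Y) (z : ℂ) :
    z ∉ A.removedPoints s q ↔ ∀ H : A.Transversal Y, z ≠ H.graph s q := by
  simp [removedPoints, eq_comm]

theorem surjective_proj (s : LineSplitting Y) : Function.Surjective (A.proj Y) := by
  intro b
  obtain ⟨z, hz⟩ := Infinite.exists_notMem_finset (A.removedPoints s b)
  rw [notMem_removedPoints_iff] at hz
  exact ⟨⟨s.point b z, (point_mem_complement_iff s b z).2 hz⟩, Subtype.ext (s.mkQ_point _ _)⟩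

theorem card_removedPoints_eq_iff (s : LineSplitting Y) (q : V ⧸ Y) :
    (A.removedPoints s q).card = (A.hyperplanes \ A.parallelTo Y).ncard ↔
      Function.Injective fun H : A.Transversal Y => H.graph s q := by
  classical
  have h : (A.hyperplanes \ A.parallelTo Y).ncard =
      (Finset.univ : Finset (A.Transversal Y)).card := by
    rw [Finset.card_univ, ← Nat.card_eq_fintype_card]
    rfl
  rw [h, ← Set.injOn_univ, ← Finset.coe_univ, ← Finset.card_image_iff, removedPoints]

/-- The part of the line over `b` outside the complement of `A` consists of the removed points. -/
theorem encard_line_diff_complement (s : LineSplitting Y) (b : (A.projected Y).complement) :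
    ((Y.mkQ ⁻¹' {(b : V ⧸ Y)}) \ A.complement).encard = ((A.removedPoints s b).card : ℕ∞) := by
  have h : (Y.mkQ ⁻¹' {(b : V ⧸ Y)}) \ A.complement = s.point b '' (A.removedPoints s b) := by
    ext v
    constructor
    · rintro ⟨hv, hvA⟩
      have hv' : Y.mkQ v = b := hv
      rw [← s.point_mkQ_coord v, hv'] at hvA ⊢
      refine ⟨_, ?_, rfl⟩
      rw [point_mem_complement_iff, ← notMem_removedPoints_iff, not_not] at hvA
      exact hvA
    · rintro ⟨z, hz, rfl⟩
      refine ⟨s.mkQ_point _ _, ?_⟩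
      rw [point_mem_complement_iff, ← notMem_removedPoints_iff, not_not]
      exact hz
  have hinj : Function.Injective (s.point (b : V ⧸ Y)) := fun z z' hz => by
    rw [← s.coord_point b z, hz, s.coord_point]
  rw [h, hinj.encard_image, Set.encard_coe_eq_coe_finsetCard]

theorem coord_notMem_removedPoints (s : LineSplitting Y) {v : V} (hv : v ∈ A.complement)
    {q : V ⧸ Y} (hq : Y.mkQ v = q) : s.coord v ∉ A.removedPoints s q := by
  subst hq
  exact (notMem_removedPoints_iff s _ _).2 ((mem_complement_iff s v).1 hv).2

section Topology

variable [TopologicalSpace V] [IsTopologicalAddGroup V] [ContinuousSMul ℂ V] [T2Space V]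
  [FiniteDimensional ℂ V]

/-- Each fiber of the projection is a plane minus the removed points. -/
noncomputable def fiberHomeomorph (A : AffineArrangement V) (s : LineSplitting Y)
    (b : (A.projected Y).complement) :
    (A.proj Y ⁻¹' {b} : Set A.complement) ≃ₜ {z : ℂ // z ∉ A.removedPoints s b} where
  toFun x := ⟨s.coord x.1, coord_notMem_removedPoints s x.1.2 (congrArg Subtype.val x.2)⟩
  invFun z := ⟨⟨s.point b z, (point_mem_complement_iff s b z).2
    ((notMem_removedPoints_iff s b z).1 z.2)⟩, Subtype.ext (s.mkQ_point _ _)⟩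
  left_inv x := by
    have hx : Y.mkQ x.1 = b := congrArg Subtype.val x.2
    refine Subtype.ext (Subtype.ext ?_)
    change s.point b (s.coord x.1) = x.1
    rw [← hx, s.point_mkQ_coord]
  right_inv z := Subtype.ext (s.coord_point _ _)
  continuous_toFun := (s.coord.continuous_of_finiteDimensional.comp
    (continuous_subtype_val.comp continuous_subtype_val)).subtype_mk _
  continuous_invFun := ((s.homeomorph.symm.continuous.comp
    (continuous_const.prodMk continuous_subtype_val)).subtype_mk _).subtype_mk _

theorem Transversal.continuous_graph (s : LineSplitting Y) (H : A.Transversal Y) :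
    Continuous (H.graph s) := by
  have : IsClosed (Y : Set V) := Y.closed_of_finiteDimensional
  rw [AffineMap.decomp]
  exact (H.graph s).linear.continuous_of_finiteDimensional.add continuous_const

/-- In coordinates, the complement of `A` is the complement of the graphs of the hyperplanes
transversal to `Y` over the complement of `A.projected Y`. -/
noncomputable def complementHomeomorph (A : AffineArrangement V) (s : LineSplitting Y) :
    A.complement ≃ₜ GraphComplement
      (fun (H : A.Transversal Y) (b : (A.projected Y).complement) => H.graph s b) where
  toFun x := ⟨(⟨Y.mkQ x, A.mapsTo_mkQ Y x.2⟩, s.coord x), ((mem_complement_iff s _).1 x.2).2⟩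
  invFun p := ⟨s.point p.1.1 p.1.2, (point_mem_complement_iff s _ _).2 p.2⟩
  left_inv _ := Subtype.ext (s.point_mkQ_coord _)
  right_inv _ := Subtype.ext (Prod.ext (Subtype.ext (s.mkQ_point _ _)) (s.coord_point _ _))
  continuous_toFun := (((continuous_fst.comp (s.homeomorph.continuous.comp
    continuous_subtype_val)).subtype_mk _).prodMk
      (s.coord.continuous_of_finiteDimensional.comp continuous_subtype_val)).subtype_mk _
  continuous_invFun := (s.homeomorph.symm.continuous.comp
    ((continuous_subtype_val.comp (continuous_fst.comp continuous_subtype_val)).prodMk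
      (continuous_snd.comp continuous_subtype_val))).subtype_mk _

end Topology

/-! ### Coincidences among the removed points -/

/-- Over every point of the complement of `A.projected Y`, distinct hyperplanes transversal to `Y`
meet the line in distinct points. -/
def Separated (A : AffineArrangement V) (s : LineSplitting Y) : Prop :=
  ∀ b ∈ (A.projected Y).complement, Function.Injective fun H : A.Transversal Y => H.graph s b

/-- Over a generic point of the base there is no coincidence among the removed points. -/
theorem exists_mem_complement_injective_graph (A : AffineArrangement V) (s : LineSplitting Y) :
    ∃ b ∈ (A.projected Y).complement, Function.Injective fun H : A.Transversal Y => H.graph s b := by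
  obtain ⟨S, hS, hne, hcompl⟩ := (A.projected Y).exists_equations
  let D : Set (V ⧸ Y →ᵃ[ℂ] ℂ) := (fun p : A.Transversal Y × A.Transversal Y =>
    p.1.graph s - p.2.graph s) '' {p | p.1 ≠ p.2}
  have hD : D.Finite := (Set.toFinite _).image _
  have hDne : ∀ f ∈ D, ∃ v, f v ≠ 0 := by
    rintro _ ⟨⟨H, H'⟩, hHH', rfl⟩
    by_contra hall
    push Not at hall
    exact hHH' (Transversal.graph_injective s (AffineMap.ext fun v => sub_eq_zero.1 (hall v)))
  obtain ⟨b, -, hb⟩ := AffineMap.exists_mem_forall_ne_zero (X := (⊤ : AffineSubspace ℂ (V ⧸ Y)))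
    ⟨0, trivial⟩ (hS.union hD) fun f hf => by
      obtain ⟨v, hv⟩ := hf.elim (hne f) (hDne f)
      exact ⟨v, trivial, hv⟩
  refine ⟨b, ?_, fun H H' h => ?_⟩
  · rw [hcompl]
    exact fun f hf => hb f (Or.inl hf)
  · by_contra hne
    exact hb _ (Or.inr ⟨(H, H'), hne, rfl⟩) (sub_eq_zero.2 h)

/-- A codimension-two flat transversal to `Y` lies in some hyperplane of `A` parallel to `Y`:
otherwise, over the image of a generic point of the flat, two of the hyperplanes that cut it out
would meet the line in the same point. -/
theorem Separated.exists_le_of_mem_rankPart {s : LineSplitting Y} (h : A.Separated s)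
    {X : AffineSubspace ℂ V} (hX : X ∈ A.rankPart 2) (hXY : ¬ Y ≤ X.direction) :
    ∃ H ∈ A.parallelTo Y, X ≤ H := by
  obtain ⟨⟨hne, S, hS, rfl⟩, hcod⟩ := hX
  by_contra! hcon
  choose f hf using fun H : A.parallelTo Y => (A.isAffineHyperplane H H.2.1).exists_equation
  have hfin : Finite (A.parallelTo Y) := (A.finite.subset fun _ h => h.1).to_subtype
  obtain ⟨x, hxX, hx⟩ := AffineMap.exists_mem_forall_ne_zero hne (Set.finite_range f) <| by
    rintro _ ⟨H, rfl⟩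
    obtain ⟨x, hx, hxH⟩ := SetLike.not_le_iff_exists.1 (hcon H H.2)
    exact ⟨x, hx, fun h0 => hxH (((hf H).1 x).2 h0)⟩
  have hxY : Y.mkQ x ∈ (A.projected Y).complement := by
    rw [mkQ_mem_complement_projected_iff]
    exact fun H hH hxH => hx _ ⟨⟨H, hH⟩, rfl⟩ (((hf ⟨H, hH⟩).1 x).1 hxH)
  have hST : ∀ H ∈ S, H ∈ A.hyperplanes \ A.parallelTo Y :=
    fun H hH => ⟨hS hH, fun hHY => hcon H hHY (sInf_le hH)⟩
  have hsub : S.Subsingleton := by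
    intro H hH H' hH'
    have hmem : ∀ K (hK : K ∈ S),
        s.coord x = Transversal.graph s (⟨K, hST K hK⟩ : A.Transversal Y) (Y.mkQ x) :=
      fun K hK => (Transversal.mem_iff s ⟨K, hST K hK⟩ x).1
        ((sInf_le hK : sInf S ≤ K) hxX)
    exact congrArg Subtype.val (h _ hxY (a₁ := ⟨H, hST H hH⟩) (a₂ := ⟨H', hST H' hH'⟩)
      ((hmem H hH).symm.trans (hmem H' hH')))
  obtain rfl | ⟨H, rfl⟩ := hsub.eq_empty_or_singleton
  · exact hXY (by simp)
  · rw [sInf_singleton, (A.isAffineHyperplane H (hS rfl)).2] at hcod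
    norm_num at hcod

variable [FiniteDimensional ℂ V]

theorem Separated.isGood {s : LineSplitting Y} (h : A.Separated s) : A.IsGood Y := by
  intro X hX
  have hadd : ∀ Z : AffineSubspace ℂ V, X ≤ Z → Y ≤ Z.direction →
      (X : Set V) + (Y : Set V) ⊆ Z := by
    rintro Z hXZ hYZ _ ⟨x, hx, y, hy, rfl⟩
    simpa [add_comm] using AffineSubspace.vadd_mem_of_mem_direction (hYZ hy) (hXZ hx)
  by_cases hXY : Y ≤ X.direction
  · exact ⟨X, hX.1, Set.Subset.antisymm
      (fun x hx => ⟨x, hx, 0, Y.zero_mem, add_zero x⟩) (hadd X le_rfl hXY)⟩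
  · obtain ⟨H, hH, hXH⟩ := h.exists_le_of_mem_rankPart hX hXY
    obtain ⟨x, hx⟩ := hX.1.1
    refine ⟨H, ⟨⟨x, hXH hx⟩, {H}, by simpa using hH.1, by simp⟩, ?_⟩
    refine Set.Subset.antisymm (fun v hv => ?_) (hadd H hXH hH.2)
    have hdir : X.direction ⊔ Y = H.direction := by
      refine Submodule.eq_of_le_of_finrank_le (sup_le (AffineSubspace.direction_le hXH) hH.2) ?_
      have h1 : Module.finrank ℂ X.direction < Module.finrank ℂ ↥(X.direction ⊔ Y) :=
        Submodule.finrank_lt_finrank_of_lt (left_lt_sup.2 hXY)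
      have h2 := (A.isAffineHyperplane H hH.1).finrank_direction
      have h3 := Submodule.finrank_quotient_add_finrank X.direction
      rw [hX.2] at h3
      omega
    have hvx : v - x ∈ X.direction ⊔ Y := by
      rw [hdir]
      exact AffineSubspace.vsub_mem_direction hv (hXH hx)
    obtain ⟨d, hd, y, hy, hdy⟩ := Submodule.mem_sup.1 hvx
    refine ⟨d + x, AffineSubspace.vadd_mem_of_mem_direction hd hx, y, hy, ?_⟩
    change d + x + y = v
    rw [add_right_comm, hdy, sub_add_cancel]

theorem finrank_quotient_direction_inf {H H' : AffineSubspace ℂ V} (hH : IsAffineHyperplane H)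
    (hH' : IsAffineHyperplane H') (hne : H ≠ H') {x : V} (hx : x ∈ H) (hx' : x ∈ H') :
    Module.finrank ℂ (V ⧸ (H ⊓ H').direction) = 2 := by
  have h1 := hH.finrank_direction
  have h2 := hH'.finrank_direction
  have h3 := Submodule.finrank_sup_add_finrank_inf_eq H.direction H'.direction
  rw [AffineSubspace.direction_inf_of_mem hx hx']
  have h4 := Submodule.finrank_quotient_add_finrank (H.direction ⊓ H'.direction)
  have h5 : Module.finrank ℂ H.direction < Module.finrank ℂ ↥(H.direction ⊔ H'.direction) := by
    refine Submodule.finrank_lt_finrank_of_lt (left_lt_sup.2 fun hle => hne ?_)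
    have hdir : H'.direction = H.direction := Submodule.eq_of_le_of_finrank_le hle (by omega)
    exact AffineSubspace.ext_of_direction_eq hdir.symm ⟨x, hx, hx'⟩
  have h6 := Submodule.finrank_le (H.direction ⊔ H'.direction)
  omega

/-- If two hyperplanes met the line over `b` in one point, then `b` would lie on the image of their
intersection, hence on a hyperplane of `A.projected Y`. -/
theorem IsGood.separated (hY : Module.finrank ℂ Y = 1) (h : A.IsGood Y) (s : LineSplitting Y) :
    A.Separated s := by
  intro b hb H H' hHH'
  by_contra hne
  have hxH : s.point b (H.graph s b) ∈ H.1 := (H.point_mem_iff s _ _).2 rfl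
  have hxH' : s.point b (H.graph s b) ∈ H'.1 := (H'.point_mem_iff s _ _).2 hHH'
  set x := s.point b (H.graph s b) with hx
  have hrank := finrank_quotient_direction_inf (A.isAffineHyperplane _ H.2.1)
    (A.isAffineHyperplane _ H'.2.1) (fun h => hne (Subtype.ext h)) hxH hxH'
  have hxX : x ∈ H.1 ⊓ H'.1 := ⟨hxH, hxH'⟩
  obtain ⟨Z, ⟨-, S, hS, rfl⟩, hZ⟩ := h (H.1 ⊓ H'.1) ⟨⟨⟨x, hxX⟩, {H.1, H'.1}, by
    rintro K (rfl | rfl)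
    exacts [H.2.1, H'.2.1], sInf_pair.symm⟩, hrank⟩
  have hmem : ∀ K ∈ S, ∀ y ∈ Y, x + y ∈ K := fun K hK y hy => by
    have hxy : x + y ∈ ((sInf S : AffineSubspace ℂ V) : Set V) := by
      rw [hZ]
      exact Set.add_mem_add hxX hy
    exact (sInf_le hK : sInf S ≤ K) hxy
  obtain ⟨K, hK⟩ : S.Nonempty := by
    rw [Set.nonempty_iff_ne_empty]
    rintro rfl
    -- A flat of codimension two and a line do not span the whole space.
    have htop : (H.1 ⊓ H'.1).direction ⊔ Y = ⊤ := by
      refine eq_top_iff.2 fun v _ => ?_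
      have hv : x + v ∈ ((H.1 ⊓ H'.1 : AffineSubspace ℂ V) : Set V) + (Y : Set V) := by
        rw [← hZ, sInf_empty]
        trivial
      obtain ⟨u, hu, y, hy, huy⟩ := hv
      have hv' : v = (u - x) + y := by
        have : u + y = x + v := huy
        rw [sub_add_eq_add_sub, this, add_sub_cancel_left]
      rw [hv']
      exact Submodule.add_mem_sup (AffineSubspace.vsub_mem_direction hu hxX) hy
    have h1 := Submodule.finrank_add_le_finrank_add_finrank (H.1 ⊓ H'.1).direction Y
    rw [htop, finrank_top] at h1
    have h2 := Submodule.finrank_quotient_add_finrank (H.1 ⊓ H'.1).direction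
    omega
  have hxK : x ∈ K := by simpa using hmem K hK 0 Y.zero_mem
  have hKY : Y ≤ K.direction := fun y hy => by
    simpa using AffineSubspace.vsub_mem_direction (hmem K hK y hy) hxK
  rw [← s.mkQ_point b (H.graph s b), ← hx, mkQ_mem_complement_projected_iff] at hb
  exact hb K ⟨hS hK, hKY⟩ hxK

end AffineArrangement

theorem mainTheorem6 (l : ℕ) (A : AffineArrangement (Fin l → ℂ))
    (Y : Submodule ℂ (Fin l → ℂ)) (hY : Module.finrank ℂ Y = 1) :
    Function.Surjective (A.proj Y) ∧
    List.TFAE [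
      IsFiberBundleMap (A.proj Y),
      ∀ b : (A.projected Y).complement,
        ((Y.mkQ ⁻¹' {(b : (Fin l → ℂ) ⧸ Y)}) \ A.complement).encard =
          ((A.hyperplanes \ A.parallelTo Y).ncard : ℕ∞),
      ∀ b : (A.projected Y).complement, ∃ S : Finset ℂ,
        S.card = (A.hyperplanes \ A.parallelTo Y).ncard ∧
          Nonempty ((A.proj Y ⁻¹' {b} : Set A.complement) ≃ₜ {z : ℂ // z ∉ S}),
      A.IsGood Y] := by
  obtain ⟨s⟩ := LineSplitting.nonempty_of_finrank_eq_one hY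
  obtain ⟨b₀, hb₀, hinj⟩ := A.exists_mem_complement_injective_graph s
  refine ⟨AffineArrangement.surjective_proj s, ?_⟩
  tfae_have 1 → 3 := by
    -- All fibers are homeomorphic to the fiber over the generic point `b₀`.
    intro h b
    obtain ⟨e⟩ := h.nonempty_homeomorph_fibers b ⟨b₀, hb₀⟩
    exact ⟨A.removedPoints s b₀, (AffineArrangement.card_removedPoints_eq_iff s b₀).2 hinj,
      ⟨e.trans (A.fiberHomeomorph s ⟨b₀, hb₀⟩)⟩⟩
  tfae_have 3 → 2 := by
    intro h b
    obtain ⟨S, hS, ⟨e⟩⟩ := h b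
    rw [AffineArrangement.encard_line_diff_complement s, ← hS,
      PuncturedPlane.card_eq_of_homeomorph ((A.fiberHomeomorph s b).symm.trans e)]
  tfae_have 2 → 4 := by
    intro h
    refine AffineArrangement.Separated.isGood (s := s) fun b hb => ?_
    have hb' := h ⟨b, hb⟩
    rw [AffineArrangement.encard_line_diff_complement s, Nat.cast_inj] at hb'
    exact (AffineArrangement.card_removedPoints_eq_iff s b).1 hb'
  tfae_have 4 → 1 := by
    intro h
    have : Nonempty (A.projected Y).complement := ⟨⟨b₀, hb₀⟩⟩
    have : PreconnectedSpace (A.projected Y).complement :=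
      Subtype.preconnectedSpace (A.projected Y).isPreconnected_complement
    have hbundle := IsFiberBundleMap.of_forall_exists_trivialization fun b =>
      GraphComplement.exists_trivialization
        (fun (H : A.Transversal Y) (b : (A.projected Y).complement) => H.graph s b)
        (fun H => (H.continuous_graph s).comp continuous_subtype_val) b (h.separated hY s b b.2)
    exact hbundle.comp_homeomorph (A.complementHomeomorph s)
  tfae_finish
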